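/- Write $\mathfrak c=|\mathbb R|$. A function $f\colon\mathbb R\to\mathbb R$ is almost continuous if every open $U\subseteq\mathbb R^2$ containing the graph of $f$ contains the graph of a continuous function $\mathbb R\to\mathbb R$; let $\mathcal A$ be the set of almost continuous functions, and let $A(\mathcal A)$ be the least cardinality of a set $F\subseteq\mathbb R^{\mathbb R}$ such that for every $g\in\mathbb R^{\mathbb R}$ there is $f\in F$ with $f+g\notin\mathcal A$. Let $\mathbb P$ be the set of all partial functions $p$ from $\mathbb R$ to $\mathbb R$ with $|\mathrm{dom}(p)|<\mathfrak c$, ordered by $p\le q$ iff $p\supseteq q$. Let $\mathbb P^*$ be the set of all pairs $(p,E)$ with $p\in\mathbb P$, $E\subseteq\mathbb R^{\mathbb R}$, $|E|<\mathfrak c$, ordered by $(p,E)\le(q,F)$ iff $p\le q$, $E\supseteq F$, and $p(x)\ne f(x)$ for all $x\in\mathrm{dom}(p)\setminus\mathrm{dom}(q)$ and $f\in F$. For a poset $Q$, a $Q$-filter is a set $G\subseteq Q$ that is upward closed and in which any two elements have a common lower bound belonging to $G$; $D\subseteq Q$ is dense if every $p\in Q$ has some $q\le p$ with $q\in D$.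 For a cardinal $\kappa$, $\mathrm{MA}_\kappa(Q)$ says: for every family $\mathcal D$ of dense subsets of $Q$ with $|\mathcal D|<\kappa$ there is a $Q$-filter meeting every member of $\mathcal D$. $\mathrm{Lus}_\kappa(Q)$ says: there is a sequence $\langle G_\alpha:\alpha<\kappa\rangle$ of $Q$-filters such that $|\{\alpha<\kappa: G_\alpha\cap D=\emptyset\}|<\kappa$ for every dense $D\subseteq Q$. Let $\kappa$ be a cardinal. Then: 1. If $\mathfrak c<\kappa$, $\kappa$ is regular and $\mathrm{Lus}_\kappa(\mathbb P^*)$ holds, then $A(\mathcal A)\le\kappa$. 2. If $\mathrm{MA}_\kappa(\mathbb P)$ holds, then $A(\mathcal A)\ge\kappa$. 3. If $\kappa$ is an (infinite) regular cardinal, then $\mathrm{Lus}_\kappa(\mathbb P^*)$ implies $\mathrm{MA}_\kappa(\mathbb P^*)$, and $\mathrm{MA}_\kappa(\mathbb P^*)$ implies $\mathrm{MA}_\kappa(\mathbb P)$. 4. Consequently, if $\mathfrak c<\kappa$, $\kappa$ is regular and $\mathrm{Lus}_\kappa(\mathbb P^*)$ holds, then $A(\mathcal A)=\kappa$. -/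

import Mathlib

open Cardinal

namespace LusinAC

/-- A function `f : ℝ → ℝ` is almost continuous (in the sense of Stallings) if every open subset of
the plane containing the graph of `f` contains the graph of a continuous function. -/
def AlmostContinuous (f : ℝ → ℝ) : Prop :=
  ∀ U : Set (ℝ × ℝ), IsOpen U → (∀ x, (x, f x) ∈ U) →
    ∃ g : ℝ → ℝ, Continuous g ∧ ∀ x, (x, g x) ∈ U

/-- The cardinal `A(𝓕)`: the least cardinality of a set `F` of real functions such that
for every `g` there is `f ∈ F` with `f + g ∉ 𝓕`. -/
noncomputable def additivity (𝓕 : Set (ℝ → ℝ)) : Cardinal.{0} :=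
  sInf {μ | ∃ F : Set (ℝ → ℝ), (∀ g : ℝ → ℝ, ∃ f ∈ F, f + g ∉ 𝓕) ∧ #F = μ}

section Poset

variable {P : Type} [PartialOrder P]

/-- `G` is a `P`-filter. (As in the source, the empty set is not excluded.) -/
def IsPosetFilter (G : Set P) : Prop :=
  (∀ p ∈ G, ∀ q ∈ G, ∃ r ∈ G, r ≤ p ∧ r ≤ q) ∧ (∀ p q : P, p ∈ G → p ≤ q → q ∈ G)

/-- `D` is dense in the poset `P` (forcing sense). -/
def IsPosetDense (D : Set P) : Prop :=
  ∀ p : P, ∃ q ∈ D, q ≤ p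

/-- Martin's Axiom `MA_κ(P)`. -/
def MartinAxiom (κ : Cardinal.{0}) (P : Type) [PartialOrder P] : Prop :=
  ∀ 𝒟 : Set (Set P), (∀ D ∈ 𝒟, IsPosetDense D) → #𝒟 < κ →
    ∃ G : Set P, IsPosetFilter G ∧ ∀ D ∈ 𝒟, (D ∩ G).Nonempty

/-- `Lus_κ(P)`: there is a `κ`-Lusin sequence of `P`-filters, indexed by the ordinals below `κ`. -/
def LusinAxiom (κ : Cardinal.{0}) (P : Type) [PartialOrder P] : Prop :=
  ∃ G : κ.ord.ToType → Set P, (∀ α, IsPosetFilter (G α)) ∧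
    ∀ D : Set P, IsPosetDense D → #{α | G α ∩ D = ∅} < κ

end Poset

/-- The poset `ℙ` of partial functions from `ℝ` to `ℝ` (given by their graphs) whose domain has
cardinality less than the continuum. -/
@[ext]
structure PartialFn : Type where
  graph : Set (ℝ × ℝ)
  functional : ∀ x y z : ℝ, (x, y) ∈ graph → (x, z) ∈ graph → y = z
  card_dom : #(Prod.fst '' graph) < 𝔠

namespace PartialFn

/-- The domain of a partial function. -/
def dom (p : PartialFn) : Set ℝ := Prod.fst '' p.graph

/-- `p ≤ q` iff `p` extends `q`. -/
instance : PartialOrder PartialFn where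
  le p q := q.graph ⊆ p.graph
  le_refl p := subset_rfl
  le_trans _ _ _ h₁ h₂ := h₂.trans h₁
  le_antisymm _ _ h₁ h₂ := PartialFn.ext (h₂.antisymm h₁)

end PartialFn

/-- The poset `ℙ*` of pairs `(p, E)` with `p ∈ ℙ` and `E` a set of fewer than continuum many
functions from `ℝ` to `ℝ`. -/
@[ext]
structure PStar : Type where
  fn : PartialFn
  side : Set (ℝ → ℝ)
  card_side : #side < 𝔠

namespace PStar

/-- `(p, E) ≤ (q, F)` iff `p ≤ q`, `F ⊆ E`, and `p(x) ≠ f(x)` for all `x ∈ dom p \ dom q`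
and all `f ∈ F`. -/
instance : PartialOrder PStar where
  le a b := a.fn ≤ b.fn ∧ b.side ⊆ a.side ∧
    ∀ x y : ℝ, (x, y) ∈ a.fn.graph → x ∉ b.fn.dom → ∀ f ∈ b.side, y ≠ f x
  le_refl a := ⟨le_rfl, subset_rfl, fun _ _ h hx => absurd ⟨_, h, rfl⟩ hx⟩
  le_trans a b c h₁ h₂ := by
    refine ⟨h₁.1.trans h₂.1, h₂.2.1.trans h₁.2.1, fun x y hxy hx f hf => ?_⟩
    by_cases hb : x ∈ b.fn.dom
    · obtain ⟨⟨x', z⟩, hz, rfl⟩ := hb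
      have hyz : y = z := a.fn.functional _ _ _ hxy (h₁.1 hz)
      exact hyz ▸ h₂.2.2 _ z hz hx f hf
    · exact h₁.2.2 x y hxy hb f (h₂.2.1 hf)
  le_antisymm _ _ h₁ h₂ := PStar.ext (le_antisymm h₁.1 h₂.1) (h₂.2.1.antisymm h₁.2.1)

end PStar

end LusinAC

/-! Both bounds turn almost continuity into a statement about where a graph meets certain sets.
Lower bound: an open set with nonempty vertical sections, fewer than `𝔠` of them proper, contains a
continuous graph (`exists_continuous_of_mk_lt`). Hence `f + g` is almost continuous once it leaves
every open `U` with `𝔠` proper sections. There are only `𝔠` such `U`, and each pair `(f, U)` defines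
a dense subset of `ℙ`. Upper bound: a Lusin sequence gives `κ > 𝔠` functions such that every `k`
agrees with one of them at fewer than `𝔠` points. Viewing each as `𝔠` functions through `ℝ × ℝ ≃ ℝ`
and adjusting values at 0 and 1 to force a sign change, almost continuity of all sums with `g` would
give `𝔠` agreements. `MA(ℙ*)` yields `MA(ℙ)` by composing with a map `ℝ → ℝ` whose fibres all have
size `𝔠`. -/

namespace LusinAC

/-! ### Continuous graphs inside open subsets of the plane -/

section Plane

variable {U : Set (ℝ × ℝ)}

/-- The points `(a, c)` and `(b, d)` are joined inside `U` by the graph of a continuous function. -/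
def Linked (U : Set (ℝ × ℝ)) (a c b d : ℝ) : Prop :=
  ∃ g : ℝ → ℝ, Continuous g ∧ g a = c ∧ g b = d ∧ ∀ t ∈ Set.Icc a b, (t, g t) ∈ U

theorem Linked.trans {a c b d e f : ℝ} (h₁ : Linked U a c b d) (h₂ : Linked U b d e f)
    (hab : a ≤ b) (hbe : b ≤ e) : Linked U a c e f := by
  obtain ⟨g₁, hg₁, ha₁, hb₁, hU₁⟩ := h₁
  obtain ⟨g₂, hg₂, ha₂, hb₂, hU₂⟩ := h₂
  refine ⟨fun t => if t ≤ b then g₁ t else g₂ t, ?_, ?_, ?_, ?_⟩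
  · refine Continuous.if_le hg₁ hg₂ continuous_id continuous_const ?_
    rintro t rfl
    exact hb₁.trans ha₂.symm
  · simp [hab, ha₁]
  · by_cases h : e ≤ b
    · obtain rfl : e = b := le_antisymm h hbe
      simp [hb₁, ← ha₂, hb₂]
    · simp [h, hb₂]
  · intro t ht
    by_cases h : t ≤ b
    · simpa [h] using hU₁ t ⟨ht.1, h⟩
    · simpa [h] using hU₂ t ⟨(not_le.1 h).le, ht.2⟩

theorem linked_const {a b y : ℝ} (h : ∀ t ∈ Set.Icc a b, (t, y) ∈ U) : Linked U a y b y :=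
  ⟨fun _ => y, continuous_const, rfl, rfl, h⟩

theorem linked_of_box {a b c d : ℝ} (hab : a < b)
    (h : ∀ t ∈ Set.Icc a b, ∀ y ∈ Set.uIcc c d, (t, y) ∈ U) : Linked U a c b d := by
  have hba : 0 < b - a := sub_pos.2 hab
  refine ⟨fun t => c + (t - a) / (b - a) * (d - c), by fun_prop, by simp, ?_, ?_⟩
  · simp [div_self hba.ne']
  · intro t ht
    refine h t ht _ ?_
    rw [← segment_eq_uIcc, segment_eq_image']
    exact ⟨(t - a) / (b - a), ⟨div_nonneg (sub_nonneg.2 ht.1) hba.le,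
      (div_le_one hba).2 (by linarith [ht.2])⟩, by simp⟩

theorem exists_tube (hU : IsOpen U) {x : ℝ} {K : Set ℝ} (hK : IsCompact K)
    (h : ∀ y ∈ K, (x, y) ∈ U) : ∃ ε > 0, ∀ t, |t - x| ≤ ε → ∀ y ∈ K, (t, y) ∈ U := by
  obtain ⟨u, v, hu, -, hxu, hKv, huv⟩ :=
    generalized_tube_lemma (isCompact_singleton (x := x)) hK hU (by
      rintro ⟨a, b⟩ ⟨ha, hb⟩
      obtain rfl : a = x := ha
      exact h b hb)
  obtain ⟨ε, hε, hball⟩ := Metric.nhds_basis_closedBall.mem_iff.1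
    (hu.mem_nhds (hxu (Set.mem_singleton x)))
  refine ⟨ε, hε, fun t ht y hy => huv ⟨hball ?_, hKv hy⟩⟩
  simpa [Real.dist_eq] using ht

theorem exists_horizontal (hU : IsOpen U) {x y : ℝ} (h : (x, y) ∈ U) :
    ∃ ε > 0, ∀ t, |t - x| ≤ ε → (t, y) ∈ U := by
  obtain ⟨ε, hε, H⟩ := exists_tube hU (isCompact_singleton (x := y)) (x := x) (by simpa using h)
  exact ⟨ε, hε, fun t ht => H t ht y rfl⟩

/-- Any two points of `U` over different points of `[s, t]` are linked. -/
def LinkedOn (U : Set (ℝ × ℝ)) (s t : ℝ) : Prop :=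
  ∀ a b, s ≤ a → a < b → b ≤ t → ∀ c d, (a, c) ∈ U → (b, d) ∈ U → Linked U a c b d

theorem LinkedOn.mono {s t s' t' : ℝ} (h : LinkedOn U s t) (hs : s ≤ s') (ht : t' ≤ t) :
    LinkedOn U s' t' :=
  fun a b ha hab hb => h a b (hs.trans ha) hab (hb.trans ht)

theorem LinkedOn.union (hne : ∀ x, ∃ y, (x, y) ∈ U) {s m t : ℝ} (h₁ : LinkedOn U s m)
    (h₂ : LinkedOn U m t) : LinkedOn U s t := by
  intro a b ha hab hb c d hc hd
  rcases le_or_gt b m with hbm | hbm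
  · exact h₁ a b ha hab hbm c d hc hd
  rcases le_or_gt m a with ham | ham
  · exact h₂ a b ham hab hb c d hc hd
  obtain ⟨y, hy⟩ := hne m
  exact (h₁ a m ha ham le_rfl c y hc hy).trans (h₂ m b le_rfl hbm hb y d hy hd) ham.le hbm.le

/-- `U` is linked on a neighbourhood of `x`. -/
def LinkedAt (U : Set (ℝ × ℝ)) (x : ℝ) : Prop :=
  ∃ ε > 0, LinkedOn U (x - ε) (x + ε)

theorem isOpen_linkedAt : IsOpen {x | LinkedAt U x} := by
  rw [Metric.isOpen_iff]
  rintro x ⟨ε, hε, h⟩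
  refine ⟨ε / 2, half_pos hε, fun z hz => ⟨ε / 2, half_pos hε, ?_⟩⟩
  rw [Metric.mem_ball, Real.dist_eq, abs_lt] at hz
  exact h.mono (by linarith) (by linarith)

theorem linkedOn_of_forall_linkedAt (hne : ∀ x, ∃ y, (x, y) ∈ U) {a b : ℝ}
    (h : ∀ x ∈ Set.Icc a b, LinkedAt U x) : LinkedOn U a b := by
  rcases lt_or_ge b a with hba | hab
  · intro s t hs hst ht
    linarith
  choose! ε hε H using h
  obtain ⟨t, ht0, -, ⟨m, hm⟩, hsub⟩ := exists_monotone_Icc_subset_open_cover_Icc hab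
    (c := fun x : Set.Icc a b => {z | (z : ℝ) ∈ Metric.ball (x : ℝ) (ε x)})
    (fun x => Metric.isOpen_ball.preimage continuous_subtype_val)
    (fun z _ => Set.mem_iUnion.2 ⟨z, Metric.mem_ball_self (hε z z.2)⟩)
  have key : ∀ n, LinkedOn U a (t n) := by
    intro n
    induction n with
    | zero =>
      intro s r hs hsr hr
      rw [ht0] at hr
      linarith
    | succ n ih =>
      refine ih.union hne ?_
      obtain ⟨x, hx⟩ := hsub n
      intro s r hs hsr hr
      have hle : t n ≤ t (n + 1) := Subtype.coe_le_coe.1 (hs.trans (hsr.le.trans hr))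
      have h1 := hx (Set.left_mem_Icc.2 hle)
      have h2 := hx (Set.right_mem_Icc.2 hle)
      simp only [Set.mem_ofPred_eq, Metric.mem_ball, Real.dist_eq, abs_lt] at h1 h2
      exact H x x.2 s r (by linarith) hsr (by linarith)
  have := key m
  rwa [hm m le_rfl] at this

theorem linked_right (hU : IsOpen U) {x t y d : ℝ} (hxt : x < t)
    (h : ∀ s, x < s → LinkedOn U s t) (hy : (x, y) ∈ U) (hd : (t, d) ∈ U) :
    Linked U x y t d := by
  obtain ⟨ε, hε, H⟩ := exists_horizontal hU hy
  obtain ⟨s, hxs, hs⟩ := exists_between (lt_min hxt (lt_add_of_pos_right x hε))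
  obtain ⟨hst, hsε⟩ := lt_min_iff.1 hs
  have hmem : ∀ r ∈ Set.Icc x s, (r, y) ∈ U := fun r hr =>
    H r (by rw [abs_le]; constructor <;> linarith [hr.1, hr.2])
  exact (linked_const hmem).trans
    (h s hxs s t le_rfl hst le_rfl y d (hmem s ⟨hxs.le, le_rfl⟩) hd) hxs.le hst.le

theorem linked_left (hU : IsOpen U) {s x c y : ℝ} (hsx : s < x)
    (h : ∀ t, t < x → LinkedOn U s t) (hc : (s, c) ∈ U) (hy : (x, y) ∈ U) :
    Linked U s c x y := by
  obtain ⟨ε, hε, H⟩ := exists_horizontal hU hy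
  obtain ⟨t, ht, htx⟩ := exists_between (max_lt hsx (sub_lt_self x hε))
  obtain ⟨hst, htε⟩ := max_lt_iff.1 ht
  have hmem : ∀ r ∈ Set.Icc t x, (r, y) ∈ U := fun r hr =>
    H r (by rw [abs_le]; constructor <;> linarith [hr.1, hr.2])
  exact (h t htx s t le_rfl hst le_rfl c y hc (hmem t ⟨le_rfl, htx.le⟩)).trans
    (linked_const hmem) hst.le htx.le

/-- A point over `x` can be left horizontally since `U` is open; off `x`, compactness links the
rest. So the non-linked points have no isolated member. -/
theorem linkedAt_of_punctured (hU : IsOpen U) (hne : ∀ x, ∃ y, (x, y) ∈ U) {x ε : ℝ} (hε : 0 < ε)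
    (h : ∀ z, |z - x| ≤ ε → z ≠ x → LinkedAt U z) : LinkedAt U x := by
  refine ⟨ε, hε, LinkedOn.union hne (m := x) ?_ ?_⟩
  · intro a b ha hab hb c d hc hd
    refine linked_left hU hab (fun t ht => ?_) hc hd
    refine linkedOn_of_forall_linkedAt hne fun z hz => h z ?_ ?_
    · rw [abs_le]
      constructor <;> linarith [hz.1, hz.2]
    · exact (hz.2.trans_lt (ht.trans_le hb)).ne
  · intro a b ha hab hb c d hc hd
    refine linked_right hU hab (fun s hs => ?_) hc hd
    refine linkedOn_of_forall_linkedAt hne fun z hz => h z ?_ ?_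
    · rw [abs_le]
      constructor <;> linarith [hz.1, hz.2]
    · exact (ha.trans_lt (hs.trans_le hz.1)).ne'

/-- Slide horizontally to a nearby full section; a thin box around it leaves room to descend to
height 0. -/
theorem exists_drop_right (hU : IsOpen U) (hN : Dense {x | ∀ y, (x, y) ∈ U}) {s c t : ℝ}
    (hst : s < t) (hc : (s, c) ∈ U) : ∃ r, s < r ∧ r < t ∧ Linked U s c r 0 := by
  obtain ⟨ε, hε, H⟩ := exists_horizontal hU hc
  obtain ⟨a, ha, hsa, hat⟩ := hN.exists_between (lt_min hst (lt_add_of_pos_right s hε))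
  obtain ⟨hat, haε⟩ := lt_min_iff.1 hat
  obtain ⟨η, hη, K⟩ := exists_tube hU (isCompact_uIcc (a := c) (b := 0)) (x := a)
    (fun y _ => ha y)
  obtain ⟨r, har, hr⟩ := exists_between (lt_min hat (lt_add_of_pos_right a hη))
  obtain ⟨hrt, hrη⟩ := lt_min_iff.1 hr
  refine ⟨r, hsa.trans har, hrt, Linked.trans (b := a) (d := c) (linked_const fun z hz => H z ?_)
    (linked_of_box har fun z hz => K z ?_) hsa.le har.le⟩ <;>
  · rw [abs_le]
    constructor <;> linarith [hz.1, hz.2]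

theorem exists_drop_left (hU : IsOpen U) (hN : Dense {x | ∀ y, (x, y) ∈ U}) {s d t : ℝ}
    (hst : s < t) (hd : (t, d) ∈ U) : ∃ r, s < r ∧ r < t ∧ Linked U r 0 t d := by
  obtain ⟨ε, hε, H⟩ := exists_horizontal hU hd
  obtain ⟨a, ha, hsa, hat⟩ := hN.exists_between (max_lt hst (sub_lt_self t hε))
  obtain ⟨hsa, haε⟩ := max_lt_iff.1 hsa
  obtain ⟨η, hη, K⟩ := exists_tube hU (isCompact_uIcc (a := 0) (b := d)) (x := a)
    (fun y _ => ha y)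
  obtain ⟨r, hr, hra⟩ := exists_between (max_lt hsa (sub_lt_self a hη))
  obtain ⟨hsr, hrη⟩ := max_lt_iff.1 hr
  refine ⟨r, hsr, hra.trans hat, Linked.trans (b := a) (d := d)
    (linked_of_box hra fun z hz => K z ?_) (linked_const fun z hz => H z ?_) hra.le hat.le⟩ <;>
  · rw [abs_le]
    constructor <;> linarith [hz.1, hz.2]

/-- Only height 0 over `x` is needed: paths drop to the horizontal axis, follow it, and climb back.
-/
theorem linkedAt_of_full_fibre (hU : IsOpen U) (hN : Dense {x | ∀ y, (x, y) ∈ U}) {x : ℝ}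
    (hx : (x, 0) ∈ U) : LinkedAt U x := by
  obtain ⟨ε, hε, H⟩ := exists_horizontal hU hx
  refine ⟨ε, hε, fun a b ha hab hb c d hc hd => ?_⟩
  obtain ⟨r, har, hrb, h₁⟩ := exists_drop_right hU hN hab hc
  obtain ⟨q, hrq, hqb, h₂⟩ := exists_drop_left hU hN hrb hd
  refine (h₁.trans (linked_const fun z hz => H z ?_) har.le hrq.le).trans h₂ (har.trans hrq).le
    hqb.le
  rw [abs_le]
  constructor <;> linarith [hz.1, hz.2]

theorem Perfect.continuum_le_mk {C : Set ℝ} (hC : Perfect C) (hne : C.Nonempty) : 𝔠 ≤ #C := by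
  obtain ⟨f, hf, -, hinj⟩ := hC.exists_nat_bool_injection hne
  have h := Cardinal.mk_le_of_injective
    (f := fun a => (⟨f a, hf (Set.mem_range_self a)⟩ : C))
    (fun a b hab => hinj (congrArg Subtype.val hab))
  simpa using h

theorem dense_compl_of_mk_lt {N : Set ℝ} (hN : #N < 𝔠) : Dense Nᶜ := by
  rw [dense_iff_exists_between]
  intro a b hab
  by_contra! h
  have hsub : Set.Ioo a b ⊆ N := fun x hx => by
    by_contra hxN
    exact absurd (h x hxN hx.1) (not_le.2 hx.2)
  have := (Cardinal.mk_le_mk_of_subset hsub).trans_lt hN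
  rw [Cardinal.mk_Ioo_real hab] at this
  exact lt_irrefl _ this

/-- The non-linked points form a perfect set of size below `𝔠`, which must be empty. -/
theorem forall_linkedAt (hU : IsOpen U) (hne : ∀ x, ∃ y, (x, y) ∈ U)
    (hN : #{x | ∃ y, (x, y) ∉ U} < 𝔠) (x : ℝ) : LinkedAt U x := by
  have hdense : Dense {x | ∀ y, (x, y) ∈ U} := by
    have h := dense_compl_of_mk_lt hN
    have e : {x | ∃ y, (x, y) ∉ U}ᶜ = {x | ∀ y, (x, y) ∈ U} := by
      ext; simp
    rwa [e] at h
  by_contra hx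
  have hperf : Perfect {x | LinkedAt U x}ᶜ := by
    refine ⟨isOpen_linkedAt.isClosed_compl, fun z hz => ?_⟩
    rw [accPt_iff_frequently]
    intro hev
    obtain ⟨ε, hε, hball⟩ := Metric.nhds_basis_closedBall.eventually_iff.1 hev
    refine hz (linkedAt_of_punctured hU hne hε fun w hw hwz => ?_)
    by_contra hwL
    exact hball (by simpa [Real.dist_eq] using hw) ⟨hwz, hwL⟩
  refine absurd (Perfect.continuum_le_mk hperf ⟨x, hx⟩) (not_le.2 ?_)
  refine (Cardinal.mk_le_mk_of_subset fun z hz => ?_).trans_lt hN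
  exact ⟨0, fun h => hz (linkedAt_of_full_fibre hU hdense h)⟩

/-- An open subset of the plane with nonempty vertical sections, all but fewer than continuum many
of which are full, contains the graph of a continuous function. -/
theorem exists_continuous_of_mk_lt (hU : IsOpen U) (hne : ∀ x, ∃ y, (x, y) ∈ U)
    (hN : #{x | ∃ y, (x, y) ∉ U} < 𝔠) : ∃ g : ℝ → ℝ, Continuous g ∧ ∀ x, (x, g x) ∈ U := by
  choose y hy using hne
  have hlink : ∀ n : ℤ, Linked U n (y n) (n + 1 : ℤ) (y (n + 1 : ℤ)) := fun n =>
    linkedOn_of_forall_linkedAt (fun x => ⟨y x, hy x⟩)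
      (fun x _ => forall_linkedAt hU (fun x => ⟨y x, hy x⟩) hN x)
      n (n + 1 : ℤ) le_rfl (by simp) le_rfl _ _ (hy _) (hy _)
  choose g hg hl hr hgU using hlink
  have hG : ∀ n : ℤ, ∀ t ∈ Set.Icc (n : ℝ) (n + 1 : ℤ), g ⌊t⌋ t = g n t := by
    intro n t ht
    -- At the right endpoint the floor already selects the next piece, which has the same value
    -- there.
    rcases ht.2.eq_or_lt with rfl | hlt
    · rw [Int.floor_intCast, hr, hl]
    · rw [Int.floor_eq_iff.2 ⟨ht.1, by simpa using hlt⟩]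
  refine ⟨fun t => g ⌊t⌋ t, ?_, fun t => hgU _ t ⟨Int.floor_le t, ?_⟩⟩
  · refine LocallyFinite.continuous (f := fun n : ℤ => Set.Icc (n : ℝ) (n + 1 : ℤ)) ?_ ?_
      (fun n => isClosed_Icc) (fun n => (hg n).continuousOn.congr (hG n))
    · intro x
      refine ⟨Set.Ioo (x - 1) (x + 1), Ioo_mem_nhds (by linarith) (by linarith),
        (Set.finite_Icc (⌊x⌋ - 2) (⌊x⌋ + 2)).subset ?_⟩
      rintro n ⟨z, ⟨h1, h2⟩, h3, h4⟩
      push_cast at h2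
      have h5 := Int.floor_le x
      have h6 := Int.lt_floor_add_one x
      have a1 : (n : ℝ) < (⌊x⌋ + 2 : ℤ) := by push_cast; linarith
      have a2 : ((⌊x⌋ - 2 : ℤ) : ℝ) < n := by push_cast; linarith
      exact ⟨(Int.cast_lt.1 a2).le, (Int.cast_lt.1 a1).le⟩
    · refine Set.eq_univ_of_forall fun x => Set.mem_iUnion.2 ⟨⌊x⌋, Int.floor_le x, ?_⟩
      simpa using (Int.lt_floor_add_one x).le
  · simpa using (Int.lt_floor_add_one t).le

end Plane

/-! ### Almost continuity and reductions for the additivity -/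

section Additivity

theorem almostContinuous_of_forall_open {f : ℝ → ℝ}
    (h : ∀ U : Set (ℝ × ℝ), IsOpen U → 𝔠 ≤ #{x | ∃ y, (x, y) ∉ U} → ∃ x, (x, f x) ∉ U) :
    AlmostContinuous f := by
  intro U hU hf
  refine exists_continuous_of_mk_lt hU (fun x => ⟨f x, hf x⟩) ?_
  by_contra hN
  obtain ⟨x, hx⟩ := h U hU (not_lt.1 hN)
  exact hx (hf x)

theorem AlmostContinuous.exists_zero {f : ℝ → ℝ} (hf : AlmostContinuous f) (h0 : f 0 < 0)
    (h1 : 0 < f 1) : ∃ x ∈ Set.Ioo (0 : ℝ) 1, f x = 0 := by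
  by_contra! hne
  -- A Z-shaped barrier: the two rays force a continuous graph avoiding it to start below and end
  -- above the segment.
  let C : Set (ℝ × ℝ) := Set.Icc 0 1 ×ˢ {0} ∪ {0} ×ˢ Set.Ici 0 ∪ {1} ×ˢ Set.Iic 0
  have hC : IsClosed C := ((isClosed_Icc.prod isClosed_singleton).union
    (isClosed_singleton.prod isClosed_Ici)).union (isClosed_singleton.prod isClosed_Iic)
  obtain ⟨g, hg, hgC⟩ := hf Cᶜ hC.isOpen_compl (by
    rintro x ((⟨hx, hy⟩ | ⟨hx, hy⟩) | ⟨hx, hy⟩)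
    · rcases hx.1.eq_or_lt with rfl | hx0
      · exact h0.ne hy
      rcases hx.2.eq_or_lt with rfl | hx1
      · exact h1.ne' hy
      exact hne x ⟨hx0, hx1⟩ hy
    · obtain rfl : x = 0 := hx
      exact not_le.2 h0 hy
    · obtain rfl : x = 1 := hx
      exact not_le.2 h1 hy)
  have hg0 : g 0 ≤ 0 := le_of_not_ge fun h => hgC 0 (Or.inl (Or.inr ⟨rfl, h⟩))
  have hg1 : 0 ≤ g 1 := le_of_not_ge fun h => hgC 1 (Or.inr ⟨rfl, h⟩)
  obtain ⟨x, hx, hx0⟩ := intermediate_value_Icc zero_le_one hg.continuousOn ⟨hg0, hg1⟩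
  exact hgC x (Or.inl (Or.inl ⟨hx, hx0⟩))

theorem le_additivity {κ : Cardinal.{0}}
    (h : ∀ F : Set (ℝ → ℝ), #F < κ → ∃ g : ℝ → ℝ, ∀ f ∈ F, AlmostContinuous (f + g)) :
    κ ≤ additivity {f | AlmostContinuous f} := by
  refine le_csInf ⟨_, Set.univ, fun g => ?_, rfl⟩ ?_
  · let s : ℝ → ℝ := fun x => if x ≤ 0 then -1 else 1
    refine ⟨s - g, trivial, fun hs => ?_⟩
    rw [sub_add_cancel] at hs
    obtain ⟨x, hx, h0⟩ := AlmostContinuous.exists_zero hs (by simp [s])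
      (by simp [s, not_le.2 (zero_lt_one (α := ℝ))])
    simp [s, not_le.2 hx.1] at h0
  · rintro _ ⟨F, hF, rfl⟩
    by_contra hlt
    obtain ⟨g, hg⟩ := h F (not_le.1 hlt)
    obtain ⟨f, hf, hfg⟩ := hF g
    exact hfg (hg f hf)

end Additivity

/-! ### Counting and choice -/

section Cardinality

theorem mk_open_sets_le {X : Type} [TopologicalSpace X] [SecondCountableTopology X] :
    #{U : Set X | IsOpen U} ≤ 𝔠 := by
  let B := TopologicalSpace.countableBasis X
  have hB := TopologicalSpace.isBasis_countableBasis X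
  have hinj : Function.Injective
      (fun U : {U : Set X | IsOpen U} => {s : B | (s : Set X) ⊆ U}) := by
    intro U V hUV
    have key : ∀ s ∈ B, s ⊆ (U : Set X) ↔ s ⊆ (V : Set X) := fun s hs =>
      Set.ext_iff.1 hUV ⟨s, hs⟩
    apply Subtype.ext
    rw [hB.open_eq_sUnion' U.2, hB.open_eq_sUnion' V.2]
    congr 1
    ext s
    exact and_congr_right fun hs => key s hs
  refine (Cardinal.mk_le_of_injective hinj).trans ?_
  rw [Cardinal.mk_set, ← Cardinal.two_power_aleph0]
  exact Cardinal.power_le_power_left two_ne_zero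
    (Cardinal.le_aleph0_iff_set_countable.2 (TopologicalSpace.countable_countableBasis X))

/-- A family of sets, each at least as large as the index set, has an injective choice function. -/
theorem exists_injective_choice {T α : Type} (s : T → Set α) (h : ∀ t, #T ≤ #(s t)) :
    ∃ φ : T → α, Function.Injective φ ∧ ∀ t, φ t ∈ s t := by
  -- Along the initial ordinal, each stage has used fewer than `#T` values.
  obtain ⟨e⟩ : Nonempty ((#T).ord.ToType ≃ T) := Cardinal.eq.1 (by simp)
  have step : ∀ i (f : ∀ j, j < i → α), ∃ x ∈ s (e i), ∀ j hj, f j hj ≠ x := by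
    intro i f
    by_contra! hcon
    refine absurd (h (e i)) (not_le.2 ?_)
    have hlt : #(Set.Iio i) < #T := by
      simpa using Cardinal.mk_Iio_lt i (by simp)
    refine lt_of_le_of_lt ?_ hlt
    refine (Cardinal.mk_le_mk_of_subset (t := Set.range fun j : Set.Iio i => f j j.2) ?_).trans
      Cardinal.mk_range_le
    intro x hx
    obtain ⟨j, hj, hjx⟩ := hcon x hx
    exact ⟨⟨j, hj⟩, hjx⟩
  choose c hc hc' using step
  let ψ : (#T).ord.ToType → α := IsWellFounded.fix (· < ·) c
  have hψ : ∀ i, ψ i = c i fun j _ => ψ j := fun i => IsWellFounded.fix_eq (· < ·) c i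
  have hlt : ∀ i j, j < i → ψ j ≠ ψ i := fun i j hj => by
    rw [hψ i]
    exact hc' i (fun j _ => ψ j) j hj
  refine ⟨fun t => ψ (e.symm t), fun a b hab => ?_, fun t => ?_⟩
  · rcases lt_trichotomy (e.symm a) (e.symm b) with hl | he | hl
    · exact absurd hab (hlt _ _ hl)
    · exact e.symm.injective he
    · exact absurd hab.symm (hlt _ _ hl)
  · have := hc (e.symm t) fun j _ => ψ j
    rwa [← hψ, e.apply_symm_apply] at this

theorem exists_mem_forall_ne {s : Set ℝ} (hs : 𝔠 ≤ #s) {E : Set (ℝ → ℝ)} (hE : #E < 𝔠) (x : ℝ) :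
    ∃ y ∈ s, ∀ f ∈ E, y ≠ f x := by
  by_contra! h
  refine absurd hs (not_le.2 (lt_of_le_of_lt ?_ hE))
  refine (Cardinal.mk_le_mk_of_subset (t := (fun f => f x) '' E) ?_).trans Cardinal.mk_image_le
  intro y hy
  obtain ⟨f, hf, hfx⟩ := h y hy
  exact ⟨f, hf, hfx.symm⟩

/-- A surjection of the line onto itself with all fibres of size continuum. -/
theorem exists_large_fibres : ∃ π : ℝ → ℝ, ∀ y, 𝔠 ≤ #(π ⁻¹' {y}) := by
  obtain ⟨e⟩ : Nonempty (ℝ ≃ ℝ × ℝ) := Cardinal.eq.1 (by simp)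
  refine ⟨fun x => (e x).1, fun y => ?_⟩
  rw [← Cardinal.mk_real]
  refine Cardinal.mk_le_of_injective (f := fun z : ℝ => ⟨e.symm (y, z), by simp⟩) ?_
  intro a b hab
  simpa using hab

end Cardinality

/-! ### Extending, amalgamating and projecting conditions -/

namespace PartialFn

theorem exists_extension (p : PartialFn) {x : ℝ} (hx : x ∉ p.dom) (y : ℝ) :
    ∃ q ≤ p, (x, y) ∈ q.graph ∧ ∀ a b, (a, b) ∈ q.graph → a ∉ p.dom → b = y ∧ a = x := by
  refine ⟨⟨insert (x, y) p.graph, ?_, ?_⟩, Set.subset_insert _ _, Set.mem_insert _ _, ?_⟩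
  · rintro a b c (h₁ | h₁) (h₂ | h₂)
    · rw [Prod.mk.injEq] at h₁ h₂
      exact h₁.2.trans h₂.2.symm
    · rw [Prod.mk.injEq] at h₁
      exact absurd ⟨_, h₂, h₁.1⟩ hx
    · rw [Prod.mk.injEq] at h₂
      exact absurd ⟨_, h₁, h₂.1⟩ hx
    · exact p.functional a b c h₁ h₂
  · rw [Set.image_insert_eq]
    exact Cardinal.mk_insert_le.trans_lt (Cardinal.add_lt_of_lt Cardinal.aleph0_le_continuum
      p.card_dom (Cardinal.one_lt_aleph0.trans Cardinal.aleph0_lt_continuum))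
  · rintro a b (h | h) ha
    · rw [Prod.mk.injEq] at h
      exact h.symm
    · exact absurd ⟨_, h, rfl⟩ ha

/-- A directed set of partial functions has a common extension to a total function. -/
theorem exists_total {S : Set PartialFn} (hS : ∀ p ∈ S, ∀ q ∈ S, ∃ r ∈ S, r ≤ p ∧ r ≤ q) :
    ∃ g : ℝ → ℝ, ∀ p ∈ S, ∀ x y, (x, y) ∈ p.graph → g x = y := by
  have h : ∀ x, ∃ z, ∀ p ∈ S, ∀ y, (x, y) ∈ p.graph → z = y := by
    intro x
    by_cases hx : ∃ z, ∃ p ∈ S, (x, z) ∈ p.graph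
    · obtain ⟨z, p, hp, hz⟩ := hx
      refine ⟨z, fun q hq y hy => ?_⟩
      obtain ⟨r, -, hrp, hrq⟩ := hS p hp q hq
      exact r.functional x z y (hrp hz) (hrq hy)
    · push Not at hx
      exact ⟨0, fun p hp y hy => absurd hy (hx y p hp)⟩
  choose g hg using h
  exact ⟨g, fun p hp x y => hg x p hp y⟩

/-- Composition of a partial function with a function on the left. -/
def comp (π : ℝ → ℝ) (p : PartialFn) : PartialFn where
  graph := {z | ∃ y, (z.1, y) ∈ p.graph ∧ π y = z.2}
  functional := by
    rintro x _ _ ⟨a, ha, rfl⟩ ⟨b, hb, rfl⟩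
    rw [p.functional x a b ha hb]
  card_dom := by
    refine (Cardinal.mk_le_mk_of_subset ?_).trans_lt p.card_dom
    rintro _ ⟨⟨x, z⟩, ⟨y, hy, -⟩, rfl⟩
    exact ⟨_, hy, rfl⟩

theorem comp_mono (π : ℝ → ℝ) {p q : PartialFn} (h : p ≤ q) : comp π p ≤ comp π q := by
  rintro z ⟨y, hy, hz⟩
  exact ⟨y, h hy, hz⟩

end PartialFn

namespace PStar

/-- Every extension of the projection of a condition lifts to an extension of the condition. -/
theorem exists_le_comp_eq {π : ℝ → ℝ} (hπ : ∀ y, 𝔠 ≤ #(π ⁻¹' {y})) (q : PStar) {p : PartialFn}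
    (hp : p ≤ q.fn.comp π) : ∃ a ≤ q, a.fn.comp π = p := by
  -- `v x y` is a code for `y` in its large `π`-fibre that the side functions do not forbid at `x`.
  choose v hv hvE using fun x y => exists_mem_forall_ne (hπ y) q.card_side x
  let Γ : Set (ℝ × ℝ) := {z | ∃ y, (z.1, y) ∈ p.graph ∧ z.1 ∉ q.fn.dom ∧ z.2 = v z.1 y}
  have hdom : Prod.fst '' (q.fn.graph ∪ Γ) ⊆ p.dom := by
    rintro _ ⟨⟨x, z⟩, h | ⟨y, hy, -⟩, rfl⟩
    · exact ⟨(x, π z), hp ⟨z, h, rfl⟩, rfl⟩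
    · exact ⟨_, hy, rfl⟩
  refine ⟨⟨⟨q.fn.graph ∪ Γ, ?_, (Cardinal.mk_le_mk_of_subset hdom).trans_lt p.card_dom⟩, q.side,
    q.card_side⟩, ⟨Set.subset_union_left, subset_rfl, ?_⟩, ?_⟩
  · rintro x y z (h₁ | ⟨a, ha, hx, h₁⟩) (h₂ | ⟨b, hb, hx', h₂⟩)
    · exact q.fn.functional x y z h₁ h₂
    · exact absurd ⟨_, h₁, rfl⟩ hx'
    · exact absurd ⟨_, h₂, rfl⟩ hx
    · dsimp only at ha hb h₁ h₂
      rw [h₁, h₂, p.functional x a b ha hb]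
  · rintro x y (h | ⟨a, ha, hx, h⟩) hxq f hf
    · exact absurd ⟨_, h, rfl⟩ hxq
    · dsimp only at h
      rw [h]
      exact hvE x a f hf
  · refine PartialFn.ext (Set.Subset.antisymm ?_ ?_)
    · rintro ⟨x, z⟩ ⟨y, h | ⟨a, ha, hx, h⟩, hz⟩
      · exact hp ⟨y, h, hz⟩
      · dsimp only at ha h hz
        have hva : π (v x a) = a := hv x a
        rw [← hz, h, hva]
        exact ha
    · rintro ⟨x, z⟩ hxz
      by_cases hx : x ∈ q.fn.dom
      · obtain ⟨⟨x, y⟩, hy, rfl⟩ := hx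
        exact ⟨y, Or.inl hy, p.functional x _ _ (hp ⟨y, hy, rfl⟩) hxz⟩
      · exact ⟨v x z, Or.inr ⟨z, hxz, hx, rfl⟩, hv x z⟩

theorem dense_mem_side (f : ℝ → ℝ) : IsPosetDense {a : PStar | f ∈ a.side} := by
  intro a
  refine ⟨⟨a.fn, insert f a.side, ?_⟩, Set.mem_insert _ _, le_rfl, Set.subset_insert _ _,
    fun x y h hx => absurd ⟨_, h, rfl⟩ hx⟩
  exact Cardinal.mk_insert_le.trans_lt (Cardinal.add_lt_of_lt Cardinal.aleph0_le_continuum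
    a.card_side (Cardinal.one_lt_aleph0.trans Cardinal.aleph0_lt_continuum))

theorem dense_mem_dom (x : ℝ) : IsPosetDense {a : PStar | x ∈ a.fn.dom} := by
  intro a
  by_cases hx : x ∈ a.fn.dom
  · exact ⟨a, hx, le_rfl⟩
  obtain ⟨y, -, hy⟩ := exists_mem_forall_ne (s := Set.univ)
    (by rw [Cardinal.mk_univ, Cardinal.mk_real]) a.card_side x
  obtain ⟨q, hq, hxq, hnew⟩ := a.fn.exists_extension hx y
  refine ⟨⟨q, a.side, a.card_side⟩, ⟨_, hxq, rfl⟩, hq, subset_rfl, fun u v huv hu f hf => ?_⟩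
  obtain ⟨rfl, rfl⟩ := hnew u v huv hu
  exact hy f hf

end PStar

/-! ### Forcing axioms and the two bounds -/

section ForcingAxioms

variable {κ : Cardinal.{0}}

/-- By regularity, fewer than `κ` exceptional sets of size below `κ` cannot cover the index set. -/
theorem exists_index_meets {P : Type} [PartialOrder P] (hκ : κ.IsRegular)
    {G : κ.ord.ToType → Set P} (hG : ∀ D : Set P, IsPosetDense D → #{α | G α ∩ D = ∅} < κ)
    {𝒟 : Set (Set P)} (h𝒟 : ∀ D ∈ 𝒟, IsPosetDense D) (hcard : #𝒟 < κ) :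
    ∃ α, ∀ D ∈ 𝒟, (D ∩ G α).Nonempty := by
  by_contra! h
  have hU : (⋃ D : 𝒟, {α | G α ∩ (D : Set P) = ∅}) = Set.univ := by
    refine Set.eq_univ_of_forall fun α => ?_
    obtain ⟨D, hD, hDα⟩ := h α
    refine Set.mem_iUnion.2 ⟨⟨D, hD⟩, ?_⟩
    change G α ∩ D = ∅
    rwa [Set.inter_comm]
  have := (Cardinal.card_iUnion_lt_iff_forall_of_isRegular hκ
    (t := fun D : 𝒟 => {α | G α ∩ (D : Set P) = ∅}) hcard).2 fun D => hG D (h𝒟 D D.2)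
  rw [hU, Cardinal.mk_univ, Cardinal.mk_ord_toType] at this
  exact lt_irrefl _ this

theorem LusinAxiom.martinAxiom {P : Type} [PartialOrder P] (hκ : κ.IsRegular)
    (h : LusinAxiom κ P) : MartinAxiom κ P := by
  obtain ⟨G, hG, hD⟩ := h
  intro 𝒟 h𝒟 hcard
  obtain ⟨α, hα⟩ := exists_index_meets hκ hD h𝒟 hcard
  exact ⟨G α, hG α, hα⟩

theorem martinAxiom_partialFn (h : MartinAxiom κ PStar) : MartinAxiom κ PartialFn := by
  obtain ⟨π, hπ⟩ := exists_large_fibres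
  intro 𝒟 h𝒟 hcard
  obtain ⟨G, hG, hmeet⟩ := h
    ((fun D : Set PartialFn => {a : PStar | a.fn.comp π ∈ D}) '' 𝒟) (by
      rintro _ ⟨D, hD, rfl⟩ q
      obtain ⟨p, hpD, hp⟩ := h𝒟 D hD (q.fn.comp π)
      obtain ⟨a, ha, rfl⟩ := PStar.exists_le_comp_eq hπ q hp
      exact ⟨a, hpD, ha⟩)
    (Cardinal.mk_image_le.trans_lt hcard)
  refine ⟨{p | ∃ a ∈ G, a.fn.comp π ≤ p}, ⟨?_, ?_⟩, ?_⟩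
  · rintro p ⟨a, ha, hap⟩ q ⟨b, hb, hbq⟩
    obtain ⟨r, hr, hra, hrb⟩ := hG.1 a ha b hb
    exact ⟨r.fn.comp π, ⟨r, hr, le_rfl⟩, (PartialFn.comp_mono π hra.1).trans hap,
      (PartialFn.comp_mono π hrb.1).trans hbq⟩
  · rintro p q ⟨a, ha, hap⟩ hpq
    exact ⟨a, ha, hap.trans hpq⟩
  · intro D hD
    obtain ⟨a, haD, haG⟩ := hmeet _ ⟨D, hD, rfl⟩
    exact ⟨_, haD, a, haG, le_rfl⟩

theorem exists_forall_add_almostContinuous (h : MartinAxiom κ PartialFn) {F : Set (ℝ → ℝ)}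
    (hF : #F < κ) : ∃ g : ℝ → ℝ, ∀ f ∈ F, AlmostContinuous (f + g) := by
  let T := F × {U : Set (ℝ × ℝ) // IsOpen U ∧ 𝔠 ≤ #{x | ∃ y, (x, y) ∉ U}}
  have hopen : #{U : Set (ℝ × ℝ) // IsOpen U ∧ 𝔠 ≤ #{x | ∃ y, (x, y) ∉ U}} ≤ 𝔠 :=
    (Cardinal.mk_subtype_mono fun U hU => hU.1).trans (mk_open_sets_le (X := ℝ × ℝ))
  have hT : #T = #F * #{U : Set (ℝ × ℝ) // IsOpen U ∧ 𝔠 ≤ #{x | ∃ y, (x, y) ∉ U}} := by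
    simp [T]
  suffices H : ∃ g : ℝ → ℝ, ∀ t : T, ∃ x, (x, t.1.1 x + g x) ∉ t.2.1 by
    obtain ⟨g, hg⟩ := H
    exact ⟨g, fun f hf => almostContinuous_of_forall_open fun U hU hN =>
      hg (⟨f, hf⟩, ⟨U, hU, hN⟩)⟩
  -- For `κ ≤ 𝔠` there may be too many pairs for `MA_κ`, but at most `𝔠`, so distinct points can be
  -- assigned to them directly.
  rcases le_or_gt κ 𝔠 with hκ | hκ
  · have hTc : #T ≤ 𝔠 := by
      rw [hT]
      exact (mul_le_mul' (hF.le.trans hκ) hopen).trans Cardinal.continuum_mul_self.le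
    obtain ⟨φ, hφ, hmem⟩ := exists_injective_choice
      (fun t : T => {x | ∃ y, (x, y) ∉ t.2.1}) (fun t => hTc.trans t.2.2.2)
    choose y hy using hmem
    refine ⟨Function.extend φ (fun t => y t - t.1.1 (φ t)) 0, fun t => ⟨φ t, ?_⟩⟩
    rw [hφ.extend_apply, add_sub_cancel]
    exact hy t
  · let D : T → Set PartialFn := fun t =>
      {p | ∃ x y, (x, y) ∈ p.graph ∧ (x, t.1.1 x + y) ∉ t.2.1}
    obtain ⟨G, hG, hmeet⟩ := h (Set.range D) (by
      rintro _ ⟨t, rfl⟩ p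
      obtain ⟨x, ⟨y, hy⟩, hx⟩ : ∃ x ∈ {x | ∃ y, (x, y) ∉ t.2.1}, x ∉ p.dom := by
        by_contra! hcon
        exact absurd ((Cardinal.mk_le_mk_of_subset hcon).trans_lt p.card_dom)
          (not_lt.2 t.2.2.2)
      obtain ⟨q, hq, hxq, -⟩ := p.exists_extension hx (y - t.1.1 x)
      exact ⟨q, ⟨x, _, hxq, by rwa [add_sub_cancel]⟩, hq⟩)
      (Cardinal.mk_range_le.trans_lt (by
        rw [hT]
        exact Cardinal.mul_lt_of_lt (Cardinal.aleph0_le_continuum.trans hκ.le) hF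
          (hopen.trans_lt hκ)))
    obtain ⟨g, hg⟩ := PartialFn.exists_total hG.1
    refine ⟨g, fun t => ?_⟩
    obtain ⟨p, ⟨x, y, hxy, hU⟩, hp⟩ := hmeet _ ⟨t, rfl⟩
    exact ⟨x, by rwa [hg p hp x y hxy]⟩

/-- From a Lusin sequence of filters, a family of `κ` functions such that each function
agrees with a member of the family at fewer than continuum many points. -/
theorem LusinAxiom.exists_family (hκ : κ.IsRegular) (hc : 𝔠 < κ) (h : LusinAxiom κ PStar) :
    ∃ Φ : κ.ord.ToType → ℝ → ℝ, ∀ k : ℝ → ℝ, ∃ α, #{x | Φ α x = k x} < 𝔠 := by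
  obtain ⟨G, hG, hD⟩ := h
  have htot : ∀ α, ∃ g : ℝ → ℝ, ∀ a ∈ G α, ∀ x y, (x, y) ∈ a.fn.graph → g x = y := by
    intro α
    obtain ⟨g, hg⟩ := PartialFn.exists_total (S := PStar.fn '' G α) (by
      rintro _ ⟨a, ha, rfl⟩ _ ⟨b, hb, rfl⟩
      obtain ⟨r, hr, hra, hrb⟩ := (hG α).1 a ha b hb
      exact ⟨_, ⟨r, hr, rfl⟩, hra.1, hrb.1⟩)
    exact ⟨g, fun a ha => hg _ ⟨a, ha, rfl⟩⟩
  choose Φ hΦ using htot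
  refine ⟨Φ, fun k => ?_⟩
  obtain ⟨α, hα⟩ := exists_index_meets hκ hD
    (𝒟 := insert {a : PStar | k ∈ a.side} (Set.range fun x => {a : PStar | x ∈ a.fn.dom})) (by
      rintro _ (rfl | ⟨x, rfl⟩)
      · exact PStar.dense_mem_side k
      · exact PStar.dense_mem_dom x)
    (Cardinal.mk_insert_le.trans_lt (Cardinal.add_lt_of_lt hκ.aleph0_le
      (Cardinal.mk_range_le.trans_lt (by rwa [Cardinal.mk_real]))
      (Cardinal.one_lt_aleph0.trans_le hκ.aleph0_le)))
  refine ⟨α, ?_⟩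
  obtain ⟨a, hka, haG⟩ := hα _ (Set.mem_insert _ _)
  -- Once `k` is in the side of `a`, every value added outside the domain of `a` differs from that
  -- of `k`.
  refine (Cardinal.mk_le_mk_of_subset fun x hx => ?_).trans_lt a.fn.card_dom
  by_contra hxa
  obtain ⟨b, ⟨⟨x, y⟩, hy, rfl⟩, hbG⟩ := hα _ (Set.mem_insert_of_mem _ ⟨x, rfl⟩)
  obtain ⟨r, -, hra, hrb⟩ := (hG α).1 a haG b hbG
  exact hra.2.2 x y (hrb.1 hy) hxa k hka ((hΦ α b hbG x y hy).symm.trans hx)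

theorem additivity_le_of_lusinAxiom (hκ : κ.IsRegular) (hc : 𝔠 < κ) (h : LusinAxiom κ PStar) :
    additivity {f | AlmostContinuous f} ≤ κ := by
  obtain ⟨Φ, hΦ⟩ := h.exists_family hκ hc
  obtain ⟨e⟩ : Nonempty (ℝ × ℝ ≃ ℝ) := Cardinal.eq.1 (by simp)
  let Ψ : κ.ord.ToType × ℝ × ℝ × ℝ → ℝ → ℝ := fun i =>
    Function.update (Function.update (fun x => Φ i.1 (e (i.2.1, x))) 0 i.2.2.1) 1 i.2.2.2
  have hcard : #(Set.range Ψ) ≤ κ := by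
    refine Cardinal.mk_range_le.trans ?_
    simp only [Cardinal.mk_prod, Cardinal.lift_id, Cardinal.mk_ord_toType, Cardinal.mk_real,
      Cardinal.continuum_mul_self]
    rw [Cardinal.mul_eq_left hκ.aleph0_le hc.le Cardinal.continuum_ne_zero]
  refine le_trans (csInf_le' ⟨Set.range Ψ, fun g => ?_, rfl⟩) hcard
  by_contra! hAC
  obtain ⟨α, hα⟩ := hΦ fun z => -g (e.symm z).2
  have hzero : ∀ ξ, ∃ x, Φ α (e (ξ, x)) = -g x := by
    intro ξ
    -- The sum with `g` is -1 at 0 and 1 at 1; its zero lies strictly between, away from both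
    -- updates.
    have hmem : AlmostContinuous _ := hAC _ ⟨(α, ξ, -1 - g 0, 1 - g 1), rfl⟩
    obtain ⟨x, hx, hx0⟩ := AlmostContinuous.exists_zero hmem
      (by simp [Ψ]) (by simp [Ψ])
    refine ⟨x, ?_⟩
    simp only [Ψ, Pi.add_apply, Function.update_of_ne hx.1.ne', Function.update_of_ne hx.2.ne]
      at hx0
    linarith
  choose x hx using hzero
  refine absurd hα (not_lt.2 ?_)
  rw [← Cardinal.mk_real]
  refine Cardinal.mk_le_of_injective (f := fun ξ : ℝ => ⟨e (ξ, x ξ), by simp [hx]⟩) ?_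
  intro a b hab
  have := e.injective (congrArg Subtype.val hab)
  exact congrArg Prod.fst this

end ForcingAxioms

end LusinAC

theorem mainTheorem9 (κ : Cardinal.{0}) :
    -- the upper bound
    (Cardinal.continuum < κ → κ.IsRegular → LusinAC.LusinAxiom κ LusinAC.PStar →
      LusinAC.additivity {f | LusinAC.AlmostContinuous f} ≤ κ) ∧
    -- the lower bound
    (LusinAC.MartinAxiom κ LusinAC.PartialFn →
      κ ≤ LusinAC.additivity {f | LusinAC.AlmostContinuous f}) ∧
    -- the comparison of the forcing axioms
    (κ.IsRegular →
      (LusinAC.LusinAxiom κ LusinAC.PStar → LusinAC.MartinAxiom κ LusinAC.PStar) ∧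
      (LusinAC.MartinAxiom κ LusinAC.PStar → LusinAC.MartinAxiom κ LusinAC.PartialFn)) ∧
    -- the resulting equality
    (Cardinal.continuum < κ → κ.IsRegular → LusinAC.LusinAxiom κ LusinAC.PStar →
      LusinAC.additivity {f | LusinAC.AlmostContinuous f} = κ) := by
  have upper : 𝔠 < κ → κ.IsRegular → LusinAC.LusinAxiom κ LusinAC.PStar →
      LusinAC.additivity {f | LusinAC.AlmostContinuous f} ≤ κ :=
    fun hc hκ h => LusinAC.additivity_le_of_lusinAxiom hκ hc h
  have lower : LusinAC.MartinAxiom κ LusinAC.PartialFn →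
      κ ≤ LusinAC.additivity {f | LusinAC.AlmostContinuous f} :=
    fun h => LusinAC.le_additivity fun _ hF => LusinAC.exists_forall_add_almostContinuous h hF
  exact ⟨upper, lower, fun hκ => ⟨fun h => h.martinAxiom hκ, LusinAC.martinAxiom_partialFn⟩,
    fun hc hκ h => le_antisymm (upper hc hκ h)
      (lower (LusinAC.martinAxiom_partialFn (h.martinAxiom hκ)))⟩
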